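/- Let $P(x,y)=P_n(x)y^n+\dots+P_0(x)$ be a polynomial in $y$ whose coefficients are polynomials in the complex variables $x=(x_1,\dots,x_N)$, and assume that $P$ is irreducible over the field $\mathbb C(x_1,\dots,x_N)$ of rational functions. Let $y(x)$ be the multivalued algebraic function defined by $P(x,y)=0$; its germs at a point $a\in\mathbb C^N$ are the germs at $a$ of analytic functions $f$ with $P(x,f(x))=0$ near $a$. Let $\Sigma\subset\mathbb C^N$ be the set $P_nJ=0$, where $J$ is the discriminant of $P$ with respect to $y$. For $x_0\in\mathbb C^N\setminus\Sigma$, the monodromy group of $y$ at $x_0$ is the group of all permutations of the set of germs of $y$ at $x_0$ that are induced by analytic continuation along loops in $\mathbb C^N\setminus\Sigma$ based at $x_0$. A germ of an analytic function at a point of $\mathbb C^N$ is said to be representable by compositions of rational functions and radicals if it belongs to the smallest class of analytic germs that 1. contains every analytic germ of a rational function of $x_1,\dots,x_N$; 2. contains, with germs $g_1,\dots,g_k$ at a point $a$, every analytic germ $f$ at $a$ with $f\cdot B(g_1,\dots,g_k)=A(g_1,\dots,g_k)$, where $A,B$ are polynomials in $k$ variables and $B(g_1,\dots,g_k)\not\equiv0$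 near $a$ (composition with the rational function $A/B$; in particular the arithmetic operations); 3. contains, with a germ $g$ at $a$, every analytic germ $f$ at $a$ with $f^q=g$ for some integer $q\ge1$ (radicals); 4. contains, with a germ, all its analytic continuations along paths in $\mathbb C^N$. Theorem. If, for some $x_0\in\mathbb C^N\setminus\Sigma$, the monodromy group of $y$ at $x_0$ is not solvable, then $y$ cannot be represented by compositions of rational functions and radicals: no germ of $y$ at any point $a\in\mathbb C^N$ is representable in this sense. -/

import Mathlib

open Filter Topology

noncomputable section

namespace AlgebraicFunctions

/-- The affine space `ℂ^N`. -/
abbrev Space (N : ℕ) : Type := Fin N → ℂ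

/-- The value at `(x, y)` of a polynomial in `y` whose coefficients are polynomials in `x`. -/
def evalAt {N : ℕ} (P : Polynomial (MvPolynomial (Fin N) ℂ)) (x : Space N) (y : ℂ) : ℂ :=
  (P.map (MvPolynomial.eval x)).eval y

/-- The hypersurface where the product of the leading coefficient and the discriminant
of `P` vanishes. -/
def singularSet {N : ℕ} (P : Polynomial (MvPolynomial (Fin N) ℂ)) : Set (Space N) :=
  {x | MvPolynomial.eval x (P.leadingCoeff * P.discr) = 0}

/-- `solutionGerms P x` is the set of all germs at `x` of analytic functions `f` with
`P(z, f z) = 0` for all `z` near `x`. -/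
def solutionGerms {N : ℕ} (P : Polynomial (MvPolynomial (Fin N) ℂ)) (x : Space N) :
    Set (Germ (𝓝 x) ℂ) :=
  {φ | ∃ f : Space N → ℂ, AnalyticAt ℂ f x ∧ (∀ᶠ z in 𝓝 x, evalAt P z (f z) = 0) ∧
    (f : Germ (𝓝 x) ℂ) = φ}

/-- The germ `ψ` at `b` is the analytic continuation of the germ `φ` at `a` along `γ`:
there is a family of analytic germs at the points `γ t`, starting at `φ` and ending at `ψ`,
in which the germs at all points `γ s` with `s` close to `t` come from one and the same
analytic function, defined near `γ t`. -/
def IsContinuation {N : ℕ} {a b : Space N} (γ : Path a b)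
    (φ : Germ (𝓝 a) ℂ) (ψ : Germ (𝓝 b) ℂ) : Prop :=
  ∃ F : unitInterval → Space N → ℂ,
    (∀ t, AnalyticAt ℂ (F t) (γ t)) ∧
    (∀ t, ∀ᶠ s in 𝓝 t, F s =ᶠ[𝓝 (γ s)] F t) ∧
    (F 0 : Germ (𝓝 a) ℂ) = φ ∧ (F 1 : Germ (𝓝 b) ℂ) = ψ

theorem IsContinuation.refl {N : ℕ} {a : Space N} {f : Space N → ℂ} (hf : AnalyticAt ℂ f a) :
    IsContinuation (Path.refl a) (f : Germ (𝓝 a) ℂ) (f : Germ (𝓝 a) ℂ) :=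
  ⟨fun _ => f, fun _ => hf, fun _ => Eventually.of_forall fun _ => EventuallyEq.rfl, rfl, rfl⟩

theorem IsContinuation.symm {N : ℕ} {a b : Space N} {γ : Path a b}
    {φ : Germ (𝓝 a) ℂ} {ψ : Germ (𝓝 b) ℂ} (h : IsContinuation γ φ ψ) :
    IsContinuation γ.symm ψ φ := by
  obtain ⟨F, hF, hloc, h0, h1⟩ := h
  refine ⟨fun t => F (unitInterval.symm t), fun t => hF _, fun t => ?_, ?_, ?_⟩
  · exact (unitInterval.continuous_symm.tendsto t).eventually (hloc (unitInterval.symm t))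
  · simpa using h1
  · simpa using h0

theorem IsContinuation.trans {N : ℕ} {a b c : Space N} {γ : Path a b} {δ : Path b c}
    {φ : Germ (𝓝 a) ℂ} {ψ : Germ (𝓝 b) ℂ} {χ : Germ (𝓝 c) ℂ}
    (h : IsContinuation γ φ ψ) (h' : IsContinuation δ ψ χ) :
    IsContinuation (γ.trans δ) φ χ := by
  obtain ⟨F, hF, hloc, h0, h1⟩ := h
  obtain ⟨G, hG, hloc', h0', h1'⟩ := h'
  have hb : F 1 =ᶠ[𝓝 b] G 0 := Germ.coe_eq.mp (h1.trans h0'.symm)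
  let u : unitInterval → unitInterval := fun t => Set.projIcc 0 1 zero_le_one (2 * (t : ℝ))
  let v : unitInterval → unitInterval := fun t => Set.projIcc 0 1 zero_le_one (2 * (t : ℝ) - 1)
  have hu : Continuous u := continuous_projIcc.comp (by fun_prop)
  have hv : Continuous v := continuous_projIcc.comp (by fun_prop)
  have hleft : ∀ t : unitInterval, (t : ℝ) ≤ 1 / 2 → (γ.trans δ) t = γ (u t) := by
    intro t ht
    have h2 : (2 * (t : ℝ)) ∈ unitInterval := ⟨by linarith [t.2.1], by linarith⟩
    rw [Path.trans_apply, dif_pos ht]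
    congr 1
    exact (Set.projIcc_of_mem zero_le_one h2).symm
  have hright : ∀ t : unitInterval, 1 / 2 ≤ (t : ℝ) → (γ.trans δ) t = δ (v t) := by
    intro t ht
    have h2 : (2 * (t : ℝ) - 1) ∈ unitInterval := ⟨by linarith, by linarith [t.2.2]⟩
    rcases ht.eq_or_lt with he | hlt
    · have hu1 : u t = 1 := by
        simp only [u]; rw [← he]; norm_num
      have hv0 : v t = 0 := by
        simp only [v]; rw [← he]; norm_num
      rw [hleft t he.ge, hu1, hv0, γ.target, δ.source]
    · rw [Path.trans_apply, dif_neg (not_le.mpr hlt)]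
      congr 1
      exact (Set.projIcc_of_mem zero_le_one h2).symm
  refine ⟨fun t => if (t : ℝ) ≤ 1 / 2 then F (u t) else G (v t), fun t => ?_, fun t => ?_, ?_, ?_⟩
  · rcases le_or_gt (t : ℝ) (1 / 2) with ht | ht
    · simpa only [if_pos ht, hleft t ht] using hF (u t)
    · simpa only [if_neg (not_le.mpr ht), hright t ht.le] using hG (v t)
  · have hFe := (hu.tendsto t).eventually (hloc (u t))
    have hGe := (hv.tendsto t).eventually (hloc' (v t))
    rcases lt_trichotomy (t : ℝ) (1 / 2) with ht | ht | ht
    · filter_upwards [hFe, continuous_subtype_val.continuousAt.eventually_lt_const ht]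
        with s hs hs'
      simpa only [if_pos ht.le, if_pos (le_of_lt hs'), hleft s (le_of_lt hs')] using hs
    · have hu1 : u t = 1 := by
        simp only [u]; rw [ht]; norm_num
      have hv0 : v t = 0 := by
        simp only [v]; rw [ht]; norm_num
      have htb : (γ.trans δ) t = b := by rw [hleft t ht.le, hu1, γ.target]
      have hlim : Tendsto (γ.trans δ) (𝓝 t) (𝓝 b) := by
        have := (γ.trans δ).continuous.tendsto t
        rwa [htb] at this
      filter_upwards [hFe, hGe, hlim.eventually hb.eventuallyEq_nhds] with s hs hs' hs''
      rcases le_or_gt (s : ℝ) (1 / 2) with h2 | h2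
      · simpa only [if_pos ht.le, if_pos h2, hleft s h2] using hs
      · rw [hv0] at hs'
        rw [hright s h2.le] at hs'' ⊢
        simpa only [if_pos ht.le, if_neg (not_le.mpr h2), hu1] using hs'.trans hs''.symm
    · filter_upwards [hGe, continuous_subtype_val.continuousAt.eventually_const_lt ht]
        with s hs hs'
      simpa only [if_neg (not_le.mpr ht), if_neg (not_le.mpr hs'), hright s (le_of_lt hs')]
        using hs
  · have hu0 : u 0 = 0 := by simp [u]
    simpa [hu0] using h0
  · have hv1 : v 1 = 1 := by simp only [v]; norm_num
    have h2 : ¬ ((1 : unitInterval) : ℝ) ≤ 1 / 2 := by norm_num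
    simpa only [if_neg h2, hv1] using h1'

/-- The monodromy group of the equation `P = 0` with base point `x₀`: all permutations of the
germs of solutions at `x₀` that are induced by analytic continuation along a loop that
avoids the singular set. -/
def monodromyGroup {N : ℕ} (P : Polynomial (MvPolynomial (Fin N) ℂ)) (x₀ : Space N)
    (hx₀ : x₀ ∉ singularSet P) : Subgroup (Equiv.Perm (solutionGerms P x₀)) where
  carrier := {σ | ∃ γ : Path x₀ x₀, (∀ t, γ t ∉ singularSet P) ∧
    ∀ φ : solutionGerms P x₀, IsContinuation γ (φ : Germ (𝓝 x₀) ℂ) (σ φ : Germ (𝓝 x₀) ℂ)}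
  one_mem' := by
    refine ⟨Path.refl x₀, fun _ => hx₀, ?_⟩
    rintro ⟨φ, f, hf, hP, rfl⟩
    exact IsContinuation.refl hf
  mul_mem' := by
    rintro σ τ ⟨γ, hγ, hσ⟩ ⟨δ, hδ, hτ⟩
    refine ⟨δ.trans γ, fun t => ?_, fun φ => (hτ φ).trans (hσ (τ φ))⟩
    rw [Path.trans_apply]
    split_ifs
    · exact hδ _
    · exact hγ _
  inv_mem' := by
    rintro σ ⟨γ, hγ, hσ⟩
    refine ⟨γ.symm, fun t => hγ _, fun φ => ?_⟩
    simpa using (hσ (σ⁻¹ φ)).symm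

/-- `IsRadicalGerm x f`: near `x`, the function `f` is analytic and its germ at `x` is a germ
of a multivalued function on `ℂ^N` that is obtained from rational functions by composition
with rational functions of several variables and with radicals. As always for multivalued
functions, an operation is performed on arbitrary germs of its arguments at a common point and
its result is everything that arises from the resulting germ by analytic continuation. -/
inductive IsRadicalGerm {N : ℕ} : Space N → (Space N → ℂ) → Prop
  /-- A rational function `A / B` of `x₁, …, x_N`. -/
  | rational (x : Space N) (A B : MvPolynomial (Fin N) ℂ) (f : Space N → ℂ)
      (hB : B ≠ 0) (hf : AnalyticAt ℂ f x)
      (h : ∀ᶠ z in 𝓝 x, f z * MvPolynomial.eval z B = MvPolynomial.eval z A) :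
      IsRadicalGerm x f
  /-- The composition `A(g₁, …, g_k) / B(g₁, …, g_k)` of a rational function of `k` variables
  with `g₁, …, g_k`, where the denominator is not identically zero. -/
  | comp (x : Space N) (k : ℕ) (A B : MvPolynomial (Fin k) ℂ) (g : Fin k → Space N → ℂ)
      (f : Space N → ℂ) (hg : ∀ i, IsRadicalGerm x (g i))
      (hB : ¬ ∀ᶠ z in 𝓝 x, MvPolynomial.eval (fun i => g i z) B = 0) (hf : AnalyticAt ℂ f x)
      (h : ∀ᶠ z in 𝓝 x, f z * MvPolynomial.eval (fun i => g i z) B =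
        MvPolynomial.eval (fun i => g i z) A) :
      IsRadicalGerm x f
  /-- A radical of degree `q` of `g`. -/
  | radical (x : Space N) (q : ℕ) (g f : Space N → ℂ) (hq : 0 < q) (hg : IsRadicalGerm x g)
      (hf : AnalyticAt ℂ f x) (h : ∀ᶠ z in 𝓝 x, f z ^ q = g z) :
      IsRadicalGerm x f
  /-- Analytic continuation along a path in `ℂ^N`. -/
  | continuation (a b : Space N) (γ : Path a b) (g f : Space N → ℂ) (hg : IsRadicalGerm a g)
      (h : IsContinuation γ (g : Germ (𝓝 a) ℂ) (f : Germ (𝓝 b) ℂ)) :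
      IsRadicalGerm b f

end AlgebraicFunctions

end

/-! ### Solvable Galois groups over an abstract field. -/

section SolvableGalois

open Polynomial IntermediateField

/-! The argument is Galois-theoretic. Put K = ℂ(x₁, …, x_N), which embeds in the field of
meromorphic germs at every point. By induction on its construction, every radical germ is a root of
a polynomial over K with solvable Galois group: such elements are closed under field operations and
radicals, and a polynomial equation survives analytic continuation by the identity principle
(`IsRadicalGerm.isSolvableGerm`). If a germ of y is radical, the irreducible P divides that
polynomial, so Gal(P/K) is solvable.

Continuation along a loop also preserves all polynomial relations over K among the solution germs at
x₀. Hence each monodromy permutation is induced by an element of Gal(P/K), and the monodromy group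
is a quotient of a subgroup of it, therefore solvable (`isSolvable_of_preserves_relations`,
`isSolvable_monodromyGroup`). Neither transitivity of the monodromy nor the number of germs at x₀
matters. -/

/-- `x` is a root of a nonzero polynomial over `F` whose Galois group is solvable. -/
def IsSolvableGaloisRoot (F : Type*) {L : Type*} [Field F] [Field L] [Algebra F L] (x : L) : Prop :=
  ∃ p : F[X], p ≠ 0 ∧ Group.IsSolvable p.Gal ∧ aeval x p = 0

variable {F L : Type*} [Field F] [Field L] [Algebra F L]

theorem Polynomial.isSolvable_gal_of_dvd {p q : F[X]} (hq : q ≠ 0) (hpq : p ∣ q)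
    (h : Group.IsSolvable q.Gal) : Group.IsSolvable p.Gal :=
  Group.isSolvable_of_surjective (Gal.restrictDvd_surjective hpq hq)

/-- The product of the polynomials of the generators has solvable group. `L` need not contain its
splitting field, so the generated field is embedded there; by normality the minimal polynomial of
`z` splits in it. -/
theorem IsSolvableGaloisRoot.of_mem_adjoin {ι : Type*} [Fintype ι] {g : ι → L}
    (hg : ∀ i, IsSolvableGaloisRoot F (g i)) {z : L}
    (hz : z ∈ IntermediateField.adjoin F (Set.range g)) : IsSolvableGaloisRoot F z := by
  choose p hp0 hps hp using hg
  have hq0 : ∏ i, p i ≠ 0 := Finset.prod_ne_zero_iff.mpr fun i _ => hp0 i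
  have hqs : Group.IsSolvable (∏ i, p i).Gal := by
    refine gal_prod_isSolvable fun q hq => ?_
    obtain ⟨i, -, rfl⟩ := Multiset.mem_map.mp hq
    exact hps i
  have hsplit := SplittingField.splits (∏ i, p i)
  have hint : ∀ i, IsIntegral F (g i) := fun i =>
    (show IsAlgebraic F (g i) from ⟨p i, hp0 i, hp i⟩).isIntegral
  obtain ⟨f⟩ : Nonempty (adjoin F (Set.range g) →ₐ[F] (∏ i, p i).SplittingField) := by
    refine nonempty_algHom_adjoin_of_splits ?_
    rintro _ ⟨i, rfl⟩
    refine ⟨hint i, hsplit.of_dvd (map_ne_zero hq0) ((map_dvd_map' _).mpr ?_)⟩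
    exact (minpoly.dvd F (g i) (hp i)).trans (Finset.dvd_prod_of_mem _ (Finset.mem_univ i))
  have hzint : IsIntegral F (⟨z, hz⟩ : adjoin F (Set.range g)) := by
    have : Algebra.IsAlgebraic F (adjoin F (Set.range g)) :=
      isAlgebraic_adjoin (by rintro _ ⟨i, rfl⟩; exact hint i)
    exact Algebra.IsIntegral.isIntegral _
  have key : minpoly F (f ⟨z, hz⟩) = minpoly F z := by
    rw [minpoly.algHom_eq f f.injective]
    exact (minpoly.algHom_eq (adjoin F (Set.range g)).val Subtype.val_injective _).symm
  refine ⟨minpoly F z, ?_, ?_, minpoly.aeval F z⟩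
  · rw [← key]
    exact minpoly.ne_zero (hzint.map f)
  · rw [← key]
    refine gal_isSolvable_of_splits ⟨Normal.splits ?_ (f ⟨z, hz⟩)⟩ hqs
    infer_instance

/-- If `p` kills `x ^ n`, then `p(X ^ n)` kills `x`. Over the splitting field of `p` it is a
constant times a product of factors `X ^ n - c`, each with solvable group; no roots of unity are
needed in `F`. -/
theorem IsSolvableGaloisRoot.of_pow {x : L} {n : ℕ} (hn : n ≠ 0)
    (h : IsSolvableGaloisRoot F (x ^ n)) : IsSolvableGaloisRoot F x := by
  obtain ⟨p, hp0, hps, hp⟩ := h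
  refine ⟨p.comp (X ^ n), fun h => ?_, ?_, by rw [aeval_comp, aeval_X_pow, hp]⟩
  · rcases comp_eq_zero_iff.mp h with h' | h'
    · exact hp0 h'
    · exact hn (by rw [← @natDegree_C F, ← h'.2, natDegree_X_pow])
  · refine gal_isSolvable_tower p (p.comp (X ^ n)) ?_ hps ?_
    · exact Gal.splits_in_splittingField_of_comp _ _ (by rwa [natDegree_X_pow])
    · obtain ⟨s, hs⟩ := splits_iff_exists_multiset.1 (SplittingField.splits p)
      rw [map_comp, Polynomial.map_pow, map_X, hs, mul_comp, C_comp]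
      apply gal_mul_isSolvable (gal_C_isSolvable _)
      rw [multiset_prod_comp]
      apply gal_prod_isSolvable
      intro q hq
      rw [Multiset.mem_map] at hq
      obtain ⟨q, hq, rfl⟩ := hq
      rw [Multiset.mem_map] at hq
      obtain ⟨q, _, rfl⟩ := hq
      rw [sub_comp, X_comp, C_comp]
      exact gal_X_pow_sub_C_isSolvable n q

theorem IsSolvableGaloisRoot.isSolvable_gal {x : L} (h : IsSolvableGaloisRoot F x) {q : F[X]}
    (hq : Irreducible q) (hx : aeval x q = 0) : Group.IsSolvable q.Gal := by
  obtain ⟨p, hp0, hps, hp⟩ := h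
  refine isSolvable_gal_of_dvd hp0 ?_ hps
  have := minpoly.dvd F x hp
  rw [← minpoly.eq_of_irreducible hq hx] at this
  exact (dvd_mul_right _ _).trans this

/-! ### From preserved relations to Galois automorphisms. -/

/-- A permutation of roots that preserves their algebraic relations is induced by an element of
the Galois group. -/
theorem exists_gal_apply_eq {p : F[X]} {S : Type*} {E : IntermediateField F L} {v : S → E}
    (hE : (MvPolynomial.aeval v : MvPolynomial S F →ₐ[F] E).range = ⊤)
    (i : E →ₐ[F] p.SplittingField) (σ : S → S)
    (hσ : ∀ r : MvPolynomial S F, MvPolynomial.aeval v r = 0 → MvPolynomial.aeval (v ∘ σ) r = 0) :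
    ∃ τ : p.Gal, ∀ s, τ (i (v s)) = i (v (σ s)) := by
  have hsurj := AlgHom.range_eq_top _ |>.mp hE
  let e := Ideal.quotientKerAlgEquivOfSurjective hsurj
  -- `E` is the polynomial ring modulo the relations of `v`; since these also hold for `v ∘ σ`,
  -- sending `v s` to `v (σ s)` is well defined on `E`.
  let l : (MvPolynomial S F ⧸ RingHom.ker (MvPolynomial.aeval v : MvPolynomial S F →ₐ[F] E)) →ₐ[F] E :=
    Ideal.Quotient.liftₐ _ (MvPolynomial.aeval (v ∘ σ)) fun r hr => hσ r hr
  let j : E →ₐ[F] p.SplittingField := (i.comp l).comp e.symm.toAlgHom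
  have hj : ∀ s, j (v s) = i (v (σ s)) := by
    intro s
    have : e.symm (v s) = Ideal.Quotient.mk _ (MvPolynomial.X s) := by
      rw [AlgEquiv.symm_apply_eq]
      simp [e]
    have hl : l (Ideal.Quotient.mk _ (MvPolynomial.X s)) = v (σ s) :=
      (Ideal.Quotient.lift_mk _ _ _).trans (MvPolynomial.aeval_X _ s)
    exact congrArg i ((congrArg l this).trans hl)
  -- With `E` acting through `i`, normality of the splitting field extends `j` along `i` to an
  -- endomorphism, which is an automorphism by algebraicity.
  let _ : Algebra E p.SplittingField := i.toAlgebra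
  have : IsScalarTower F E p.SplittingField :=
    IsScalarTower.of_algebraMap_eq' i.comp_algebraMap.symm
  have : Normal F p.SplittingField := SplittingField.instNormal p
  let t : p.SplittingField →ₐ[F] p.SplittingField := j.liftNormal p.SplittingField
  have ht : ∀ x : E, t (i x) = j x := fun x => j.liftNormal_commutes p.SplittingField x
  refine ⟨Algebra.IsAlgebraic.algEquivEquivAlgHom F p.SplittingField |>.symm t, fun s => ?_⟩
  rw [← hj, ← ht]
  rfl

theorem isSolvable_of_preserves_relations {p : F[X]} (hp0 : p ≠ 0) (hps : Group.IsSolvable p.Gal)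
    {S : Type*} {v : S → L} (hinj : Function.Injective v) (hv : ∀ s, aeval (v s) p = 0)
    (G : Subgroup (Equiv.Perm S))
    (hG : ∀ σ ∈ G, ∀ r : MvPolynomial S F,
      MvPolynomial.aeval v r = 0 → MvPolynomial.aeval (v ∘ σ) r = 0) :
    Group.IsSolvable G := by
  have hint : ∀ s, IsIntegral F (v s) := fun s =>
    (show IsAlgebraic F (v s) from ⟨p, hp0, hv s⟩).isIntegral
  let E := adjoin F (Set.range v)
  let w : S → E := fun s => ⟨v s, subset_adjoin F _ ⟨s, rfl⟩⟩
  have hw : ∀ (w' : S → E) (r : MvPolynomial S F),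
      ((MvPolynomial.aeval w' r : E) : L) = MvPolynomial.aeval (fun s => (w' s : L)) r := by
    intro w' r
    exact (MvPolynomial.comp_aeval_apply w' E.val r)
  have hE : (MvPolynomial.aeval w : MvPolynomial S F →ₐ[F] E).range = ⊤ := by
    rw [AlgHom.range_eq_top]
    rintro ⟨x, hx⟩
    have hx' : x ∈ (adjoin F (Set.range v)).toSubalgebra := hx
    rw [adjoin_toSubalgebra_of_isAlgebraic (by rintro _ ⟨s, rfl⟩; exact (hint s).isAlgebraic),
      Algebra.adjoin_range_eq_range_aeval] at hx'
    obtain ⟨r, hr⟩ := hx'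
    exact ⟨r, Subtype.ext ((hw w r).trans hr)⟩
  obtain ⟨i⟩ : Nonempty (E →ₐ[F] p.SplittingField) := by
    refine nonempty_algHom_adjoin_of_splits ?_
    rintro _ ⟨s, rfl⟩
    exact ⟨hint s, (SplittingField.splits p).of_dvd (map_ne_zero hp0)
      ((map_dvd_map' _).mpr (minpoly.dvd F (v s) (hv s)))⟩
  have hiw : Function.Injective fun s => i (w s) := fun s t h =>
    hinj (congrArg Subtype.val (i.injective h))
  -- The automorphism inducing `σ` need not be unique, as the `v s` may not generate the splitting
  -- field. So all compatible pairs are taken: they inject into `p.Gal`, because `v` is injective,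
  -- and surject onto `G`.
  let R : Subgroup (p.Gal × G) :=
    { carrier := {x | ∀ s, x.1 (i (w s)) = i (w (x.2.1 s))}
      one_mem' := fun s => rfl
      mul_mem' := by
        rintro ⟨τ, σ⟩ ⟨τ', σ'⟩ h h' s
        change τ (τ' (i (w s))) = i (w (σ.1 (σ'.1 s)))
        rw [h' s, h]
      inv_mem' := by
        rintro ⟨τ, σ⟩ h s
        have hs := h (σ.1.symm s)
        rw [Equiv.apply_symm_apply] at hs
        exact (AlgEquiv.symm_apply_eq (e := (τ : Gal(p.SplittingField/F)))).mpr hs.symm }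
  have hR : Group.IsSolvable R := by
    refine Group.isSolvable_of_isSolvable_injective (f := (MonoidHom.fst p.Gal G).comp R.subtype) ?_
    rw [injective_iff_map_eq_one]
    rintro ⟨⟨τ, σ⟩, h⟩ (hτ : τ = 1)
    subst hτ
    have : σ = 1 := Subtype.ext <| Equiv.ext fun s => (hiw (h s)).symm
    subst this
    rfl
  refine Group.isSolvable_of_surjective (f := (MonoidHom.snd p.Gal G).comp R.subtype) ?_
  rintro ⟨σ, hσ⟩
  obtain ⟨τ, hτ⟩ := exists_gal_apply_eq (p := p) hE i σ fun r hr => Subtype.ext <| by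
    rw [hw]
    refine hG σ hσ r ?_
    rw [← hw w, hr]
    rfl
  exact ⟨⟨⟨τ, ⟨σ, hσ⟩⟩, hτ⟩, rfl⟩

/-- Common denominators: a relation over rational functions becomes one with polynomial
coefficients, which can be evaluated at every point. -/
theorem MvPolynomial.exists_map_eq_C_mul {A K S : Type*} [CommRing A] [IsDomain A] [Field K]
    [Algebra A K] [IsFractionRing A K] (r : MvPolynomial S K) :
    ∃ d : A, d ≠ 0 ∧ ∃ q : MvPolynomial S A,
      MvPolynomial.map (algebraMap A K) q = C (algebraMap A K d) * r := by
  induction r using MvPolynomial.induction_on with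
  | C c =>
    obtain ⟨a, b, hb, rfl⟩ := IsFractionRing.div_surjective (A := A) c
    have hb0 : algebraMap A K b ≠ 0 := IsFractionRing.to_map_ne_zero_of_mem_nonZeroDivisors hb
    refine ⟨b, nonZeroDivisors.ne_zero hb, C a, ?_⟩
    rw [map_C, ← C_mul, mul_div_cancel₀ _ hb0]
  | add r s hr hs =>
    obtain ⟨d, hd, q, hq⟩ := hr
    obtain ⟨e, he, t, ht⟩ := hs
    refine ⟨d * e, mul_ne_zero hd he, C e * q + C d * t, ?_⟩
    simp only [map_add, map_mul, map_C, hq, ht]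
    ring
  | mul_X r s hr =>
    obtain ⟨d, hd, q, hq⟩ := hr
    exact ⟨d, hd, q * X s, by rw [map_mul, hq, map_X, mul_assoc]⟩

end SolvableGalois

/-! ### The field of meromorphic germs. -/

noncomputable section
namespace AlgebraicFunctions

variable {N : ℕ}

theorem eventuallyEq_zero_of_analyticOnNhd_ball {f : Space N → ℂ} {x y z : Space N} {r : ℝ}
    (hf : AnalyticOnNhd ℂ f (Metric.ball x r)) (hy : y ∈ Metric.ball x r)
    (hz : z ∈ Metric.ball x r) (h : f =ᶠ[𝓝 y] 0) : f =ᶠ[𝓝 z] 0 :=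
  (hf.eqOn_zero_of_preconnected_of_eventuallyEq_zero (convex_ball x r).isPreconnected hy
    h).eventuallyEq_of_mem (Metric.isOpen_ball.mem_nhds hz)

/-- If `f` is nonzero at some point of a small ball, `g` vanishes near that point, hence near `x` by
the identity theorem. Germs thus form a domain, and the residue field at `vanishingIdeal` is its
fraction field. -/
theorem eventuallyEq_zero_or_of_mul {f g : Space N → ℂ} {x : Space N} (hf : AnalyticAt ℂ f x)
    (hg : AnalyticAt ℂ g x) (h : f * g =ᶠ[𝓝 x] 0) : f =ᶠ[𝓝 x] 0 ∨ g =ᶠ[𝓝 x] 0 := by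
  obtain ⟨r, hr, hball⟩ := Metric.eventually_nhds_iff_ball.mp
    (hf.eventually_analyticAt.and (hg.eventually_analyticAt.and h))
  by_cases hf0 : f =ᶠ[𝓝 x] 0
  · exact .inl hf0
  refine .inr ?_
  have : ∃ y ∈ Metric.ball x r, f y ≠ 0 := by
    by_contra! hcon
    exact hf0 (Metric.eventually_nhds_iff_ball.mpr ⟨r, hr, hcon⟩)
  obtain ⟨y, hy, hfy⟩ := this
  refine eventuallyEq_zero_of_analyticOnNhd_ball (fun z hz => (hball z hz).2.1) hy
    (Metric.mem_ball_self hr) ?_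
  filter_upwards [(hball y hy).1.continuousAt.eventually_ne hfy,
    Metric.isOpen_ball.mem_nhds hy] with z hz hz'
  exact (mul_eq_zero.mp (hball z hz').2.2).resolve_left hz

/-- The functions that are analytic at `x`. -/
def analyticFunctions (x : Space N) : Subring (Space N → ℂ) where
  carrier := {f | AnalyticAt ℂ f x}
  mul_mem' hf hg := AnalyticAt.mul hf hg
  one_mem' := analyticAt_const
  add_mem' hf hg := AnalyticAt.add hf hg
  zero_mem' := analyticAt_const
  neg_mem' hf := AnalyticAt.neg hf

/-- The functions analytic at `x` that vanish near `x`. -/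
def vanishingIdeal (x : Space N) : Ideal (analyticFunctions x) where
  carrier := {f | (f : Space N → ℂ) =ᶠ[𝓝 x] 0}
  add_mem' {f g} hf hg := by
    filter_upwards [hf, hg] with z hz hz'
    simp [hz, hz']
  zero_mem' := EventuallyEq.rfl
  smul_mem' c f hf := by
    filter_upwards [hf] with z hz
    simp [hz]

theorem mem_vanishingIdeal {x : Space N} {f : analyticFunctions x} :
    f ∈ vanishingIdeal x ↔ (f : Space N → ℂ) =ᶠ[𝓝 x] 0 := Iff.rfl

instance (x : Space N) : (vanishingIdeal x).IsPrime where
  ne_top' h := by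
    have h1 : (1 : analyticFunctions x) ∈ vanishingIdeal x := h ▸ Submodule.mem_top
    exact one_ne_zero (mem_vanishingIdeal.mp h1).eq_of_nhds
  mem_or_mem' {f g} h := eventuallyEq_zero_or_of_mul f.2 g.2 h

/-- The field of meromorphic germs at `x`. -/
abbrev GermField (x : Space N) : Type := (vanishingIdeal x).ResidueField

/-- The meromorphic germ of a function that is analytic at `x`. -/
def toGermField (x : Space N) : analyticFunctions x →+* GermField x := algebraMap _ _

theorem toGermField_eq_zero {x : Space N} {f : analyticFunctions x} :
    toGermField x f = 0 ↔ (f : Space N → ℂ) =ᶠ[𝓝 x] 0 :=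
  Ideal.algebraMap_residueField_eq_zero

/-- The function of a polynomial, as a function that is analytic at `x`. -/
def polyFun (x : Space N) : MvPolynomial (Fin N) ℂ →+* analyticFunctions x where
  toFun p := ⟨fun z => MvPolynomial.eval z p, AnalyticOnNhd.eval_mvPolynomial p x trivial⟩
  map_one' := Subtype.ext <| funext fun _ => map_one _
  map_mul' _ _ := Subtype.ext <| funext fun _ => map_mul _ _ _
  map_zero' := Subtype.ext <| funext fun _ => map_zero _
  map_add' _ _ := Subtype.ext <| funext fun _ => map_add _ _ _

theorem polyFun_eventuallyEq_zero {x : Space N} {p : MvPolynomial (Fin N) ℂ}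
    (h : (fun z => MvPolynomial.eval z p) =ᶠ[𝓝 x] 0) : p = 0 := by
  refine MvPolynomial.funext fun z => ?_
  rw [map_zero]
  exact congrFun ((AnalyticOnNhd.eval_mvPolynomial (𝕜 := ℂ) p).eq_of_eventuallyEq
    (g := 0) (fun _ _ => analyticAt_const) h) z

/-- The field of rational functions in `N` complex variables. -/
abbrev RationalFunctions (N : ℕ) : Type := FractionRing (MvPolynomial (Fin N) ℂ)

theorem toGermField_comp_polyFun_injective (x : Space N) :
    Function.Injective ((toGermField x).comp (polyFun x)) :=
  (injective_iff_map_eq_zero _).mpr fun _ hp => polyFun_eventuallyEq_zero (toGermField_eq_zero.mp hp)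

instance (x : Space N) : Algebra (RationalFunctions N) (GermField x) :=
  (IsFractionRing.lift (toGermField_comp_polyFun_injective x)).toAlgebra

theorem algebraMap_rationalFunctions (x : Space N) (p : MvPolynomial (Fin N) ℂ) :
    algebraMap (RationalFunctions N) (GermField x) (algebraMap _ _ p) =
      toGermField x (polyFun x p) :=
  IsFractionRing.lift_algebraMap (toGermField_comp_polyFun_injective x) p

/-- Evaluation at a point of functions that are analytic at `x`. -/
def evalHom (x z : Space N) : analyticFunctions x →+* ℂ :=
  (Pi.evalRingHom (fun _ : Space N => ℂ) z).comp (analyticFunctions x).subtype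

theorem evalHom_comp_polyFun (x z : Space N) : (evalHom x z).comp (polyFun x) =
    MvPolynomial.eval z := rfl

/-- The bridge between algebra over the rational functions and pointwise identities near `x`. -/
theorem aeval_toGermField_map (x : Space N) (f : analyticFunctions x)
    (q : Polynomial (MvPolynomial (Fin N) ℂ)) :
    Polynomial.aeval (toGermField x f) (q.map (algebraMap _ (RationalFunctions N))) = 0 ↔
      ∀ᶠ z in 𝓝 x, evalAt q z (f.1 z) = 0 := by
  have h1 : Polynomial.aeval (toGermField x f) (q.map (algebraMap _ (RationalFunctions N))) =
      toGermField x (q.eval₂ (polyFun x) f) := by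
    rw [Polynomial.aeval_def, Polynomial.eval₂_map, Polynomial.hom_eval₂]
    congr 1
    exact RingHom.ext (algebraMap_rationalFunctions x)
  rw [h1, toGermField_eq_zero]
  refine eventually_congr (Eventually.of_forall fun z => ?_)
  rw [evalAt, Polynomial.eval_map, ← evalHom_comp_polyFun x z]
  change evalHom x z _ = 0 ↔ _
  rw [Polynomial.hom_eval₂]
  rfl

theorem aeval_toGermField_mvMap {S : Type*} (x : Space N) (f : S → analyticFunctions x)
    (q : MvPolynomial S (MvPolynomial (Fin N) ℂ)) :
    MvPolynomial.aeval (fun s => toGermField x (f s))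
        (MvPolynomial.map (algebraMap _ (RationalFunctions N)) q) = 0 ↔
      (fun z => q.eval₂ (MvPolynomial.eval z) fun s => (f s).1 z) =ᶠ[𝓝 x] 0 := by
  have h1 : MvPolynomial.aeval (fun s => toGermField x (f s))
      (MvPolynomial.map (algebraMap _ (RationalFunctions N)) q) =
      toGermField x (q.eval₂ (polyFun x) f) := by
    rw [MvPolynomial.aeval_def, MvPolynomial.eval₂_map]
    refine Eq.trans ?_ (MvPolynomial.eval₂_comp_left (toGermField x) (polyFun x) f q).symm
    congr 1
    exact RingHom.ext (algebraMap_rationalFunctions x)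
  rw [h1, toGermField_eq_zero]
  refine eventually_congr (Eventually.of_forall fun z => ?_)
  change evalHom x z _ = 0 ↔ _
  rw [MvPolynomial.eval₂_comp_left, evalHom_comp_polyFun]
  rfl

/-! ### Persistence of polynomial relations under continuation. -/

theorem analyticAt_mvEval₂ {S : Type*} {x : Space N} {f : S → Space N → ℂ}
    (hf : ∀ s, AnalyticAt ℂ (f s) x) (q : MvPolynomial S (MvPolynomial (Fin N) ℂ)) :
    AnalyticAt ℂ (fun z => q.eval₂ (MvPolynomial.eval z) fun s => f s z) x := by
  induction q using MvPolynomial.induction_on with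
  | C a => simpa using AnalyticOnNhd.eval_mvPolynomial a x trivial
  | add p q hp hq => simpa only [MvPolynomial.eval₂_add] using! hp.add hq
  | mul_X p s hp => simpa only [MvPolynomial.eval₂_mul, MvPolynomial.eval₂_X] using! hp.mul (hf s)

/-- `S` may be infinite, so there need not be one neighbourhood of `t` that serves all `i`;
induction on `q` uses only the finitely many variables that occur. -/
theorem eventually_eventuallyEq_mvEval₂ {S : Type*} {a b : Space N} {γ : Path a b}
    {F : S → unitInterval → Space N → ℂ} {t : unitInterval}
    (hF : ∀ i, ∀ᶠ s in 𝓝 t, F i s =ᶠ[𝓝 (γ s)] F i t)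
    (q : MvPolynomial S (MvPolynomial (Fin N) ℂ)) :
    ∀ᶠ s in 𝓝 t, (fun z => q.eval₂ (MvPolynomial.eval z) fun i => F i s z) =ᶠ[𝓝 (γ s)]
      fun z => q.eval₂ (MvPolynomial.eval z) fun i => F i t z := by
  induction q using MvPolynomial.induction_on with
  | C a => simp
  | add p q hp hq =>
    filter_upwards [hp, hq] with s hs hs'
    simpa only [MvPolynomial.eval₂_add] using! hs.add hs'
  | mul_X p i hp =>
    filter_upwards [hp, hF i] with s hs hs'
    simpa only [MvPolynomial.eval₂_mul, MvPolynomial.eval₂_X] using! hs.mul hs'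

theorem eventuallyEq_mvEval₂ {S : Type*} {x : Space N} {f g : S → Space N → ℂ}
    (h : ∀ i, f i =ᶠ[𝓝 x] g i) (q : MvPolynomial S (MvPolynomial (Fin N) ℂ)) :
    (fun z => q.eval₂ (MvPolynomial.eval z) fun i => f i z) =ᶠ[𝓝 x]
      fun z => q.eval₂ (MvPolynomial.eval z) fun i => g i z := by
  induction q using MvPolynomial.induction_on with
  | C a => simp
  | add p q hp hq => simpa only [MvPolynomial.eval₂_add] using! hp.add hq
  | mul_X p i hp => simpa only [MvPolynomial.eval₂_mul, MvPolynomial.eval₂_X] using! hp.mul (h i)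

/-- The identity principle along a path. -/
theorem eventuallyEq_zero_along_path {a b : Space N} {γ : Path a b} {F : unitInterval → Space N → ℂ}
    (hF : ∀ t, AnalyticAt ℂ (F t) (γ t))
    (hloc : ∀ t, ∀ᶠ s in 𝓝 t, F s =ᶠ[𝓝 (γ s)] F t) (h0 : F 0 =ᶠ[𝓝 (γ 0)] 0) (t : unitInterval) :
    F t =ᶠ[𝓝 (γ t)] 0 := by
  -- Vanishing of the germ is locally constant in `t`, so it holds on a clopen subset of the
  -- connected interval.
  have key : ∀ t, ∀ᶠ s in 𝓝 t, (F s =ᶠ[𝓝 (γ s)] 0 ↔ F t =ᶠ[𝓝 (γ t)] 0) := by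
    intro t
    obtain ⟨r, hr, hball⟩ := Metric.eventually_nhds_iff_ball.mp (hF t).eventually_analyticAt
    filter_upwards [hloc t, γ.continuous.continuousAt.eventually
      (Metric.ball_mem_nhds (γ t) hr)] with s hs hs'
    constructor
    · exact fun h => eventuallyEq_zero_of_analyticOnNhd_ball hball hs' (Metric.mem_ball_self hr)
        (hs.symm.trans h)
    · exact fun h => hs.trans
        (eventuallyEq_zero_of_analyticOnNhd_ball hball (Metric.mem_ball_self hr) hs' h)
  have hclopen : IsClopen {t | F t =ᶠ[𝓝 (γ t)] 0} := by
    refine ⟨⟨?_⟩, ?_⟩ <;> rw [isOpen_iff_mem_nhds] <;> intro t ht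
    · filter_upwards [key t] with s hs h
      exact ht (hs.mp h)
    · filter_upwards [key t] with s hs
      exact hs.mpr ht
  have := hclopen.eq_univ ⟨0, h0⟩
  exact this.ge (Set.mem_univ t)

/-! ### Radical germs have solvable Galois groups. -/

/-- `f` is analytic at `x` and its germ is algebraic over the field of rational functions, with a
solvable Galois group. -/
def IsSolvableGerm (x : Space N) (f : Space N → ℂ) : Prop :=
  ∃ hf : AnalyticAt ℂ f x, IsSolvableGaloisRoot (RationalFunctions N) (toGermField x ⟨f, hf⟩)

/-- Germs at different points lie in different fields; a witness with polynomial coefficients makes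
sense at all points and can be carried along a path. -/
theorem isSolvableGerm_iff {x : Space N} {f : Space N → ℂ} : IsSolvableGerm x f ↔
    AnalyticAt ℂ f x ∧ ∃ q : Polynomial (MvPolynomial (Fin N) ℂ), q ≠ 0 ∧
      Group.IsSolvable (q.map (algebraMap _ (RationalFunctions N))).Gal ∧
      ∀ᶠ z in 𝓝 x, evalAt q z (f z) = 0 := by
  have hinj := IsFractionRing.injective (MvPolynomial (Fin N) ℂ) (RationalFunctions N)
  constructor
  · rintro ⟨hf, p, hp0, hps, hp⟩
    obtain ⟨b, hb, hq⟩ := IsLocalization.integerNormalization_spec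
      (nonZeroDivisors (MvPolynomial (Fin N) ℂ)) p
    set q := IsLocalization.integerNormalization (nonZeroDivisors (MvPolynomial (Fin N) ℂ)) p
    have hq' : q.map (algebraMap _ (RationalFunctions N)) =
        Polynomial.C (algebraMap _ (RationalFunctions N) b) * p := by
      rw [hq, ← Polynomial.smul_eq_C_mul, algebraMap_smul]
    have hb0 : algebraMap _ (RationalFunctions N) b ≠ 0 :=
      IsFractionRing.to_map_ne_zero_of_mem_nonZeroDivisors hb
    refine ⟨hf, q, ?_, ?_, ?_⟩
    · rintro h
      rw [h, Polynomial.map_zero, eq_comm, mul_eq_zero, Polynomial.C_eq_zero] at hq'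
      exact hq'.elim hb0 hp0
    · rw [hq']
      exact gal_mul_isSolvable (gal_C_isSolvable _) hps
    · refine (aeval_toGermField_map x ⟨f, hf⟩ q).mp ?_
      rw [hq', map_mul, hp, mul_zero]
  · rintro ⟨hf, q, hq0, hqs, hq⟩
    exact ⟨hf, _, (Polynomial.map_ne_zero_iff hinj).mpr hq0, hqs,
      (aeval_toGermField_map x ⟨f, hf⟩ q).mpr hq⟩

theorem evalAt_eq_mvEval₂ (q : Polynomial (MvPolynomial (Fin N) ℂ)) (z : Space N) (y : ℂ) :
    evalAt q z y = (q.eval₂ MvPolynomial.C (MvPolynomial.X ())).eval₂ (MvPolynomial.eval z)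
      fun _ : Unit => y := by
  change _ = MvPolynomial.eval₂Hom _ _ _
  rw [Polynomial.hom_eval₂, MvPolynomial.eval₂Hom_comp_C, evalAt, Polynomial.eval_map,
    MvPolynomial.eval₂Hom_X']

theorem IsContinuation.eventually_evalAt_eq_zero {a b : Space N} {γ : Path a b}
    {g f : Space N → ℂ} (h : IsContinuation γ (g : Germ (𝓝 a) ℂ) (f : Germ (𝓝 b) ℂ))
    {q : Polynomial (MvPolynomial (Fin N) ℂ)} (hq : ∀ᶠ z in 𝓝 a, evalAt q z (g z) = 0) :
    ∀ᶠ z in 𝓝 b, evalAt q z (f z) = 0 := by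
  obtain ⟨F, hF, hloc, h0, h1⟩ := h
  have key := eventuallyEq_zero_along_path (γ := γ)
    (F := fun t z => (q.eval₂ MvPolynomial.C (MvPolynomial.X ())).eval₂ (MvPolynomial.eval z)
      fun _ : Unit => F t z)
    (fun t => analyticAt_mvEval₂ (fun _ => hF t) _)
    (fun t => eventually_eventuallyEq_mvEval₂ (F := fun _ => F) (fun _ => hloc t) _) (by
      rw [γ.source]
      filter_upwards [hq, Germ.coe_eq.mp h0] with z hz hz'
      rw [hz', ← evalAt_eq_mvEval₂, hz]
      rfl) 1
  rw [γ.target] at key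
  filter_upwards [key, Germ.coe_eq.mp h1] with z hz hz'
  rw [evalAt_eq_mvEval₂, ← hz']
  exact hz

theorem IsSolvableGerm.continuation {a b : Space N} {γ : Path a b} {g f : Space N → ℂ}
    (hg : IsSolvableGerm a g)
    (h : IsContinuation γ (g : Germ (𝓝 a) ℂ) (f : Germ (𝓝 b) ℂ)) : IsSolvableGerm b f := by
  rw [isSolvableGerm_iff] at hg ⊢
  obtain ⟨-, q, hq0, hqs, hq⟩ := hg
  refine ⟨?_, q, hq0, hqs, h.eventually_evalAt_eq_zero hq⟩
  obtain ⟨F, hF, -, -, h1⟩ := h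
  have := hF 1
  rw [γ.target] at this
  exact this.congr (Germ.coe_eq.mp h1)

theorem toGermField_eq {x : Space N} {f g : analyticFunctions x}
    (h : (f : Space N → ℂ) =ᶠ[𝓝 x] g) : toGermField x f = toGermField x g := by
  rw [← sub_eq_zero, ← map_sub, toGermField_eq_zero]
  filter_upwards [h] with z hz
  simp [hz]

theorem exists_toGermField_mem_adjoin {x : Space N} {k : ℕ} (g : Fin k → analyticFunctions x)
    (A : MvPolynomial (Fin k) ℂ) : ∃ a : analyticFunctions x,
      (∀ z, a.1 z = MvPolynomial.eval (fun i => (g i).1 z) A) ∧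
      toGermField x a ∈ IntermediateField.adjoin (RationalFunctions N)
        (Set.range fun i => toGermField x (g i)) := by
  refine ⟨A.eval₂ ((polyFun x).comp MvPolynomial.C) g, fun z => ?_, ?_⟩
  · change evalHom x z _ = _
    rw [MvPolynomial.eval₂_comp_left, ← RingHom.comp_assoc, evalHom_comp_polyFun]
    change _ = MvPolynomial.eval₂ _ _ A
    congr 1
    exact RingHom.ext fun c => MvPolynomial.eval_C c
  · induction A using MvPolynomial.induction_on with
    | C c =>
      rw [MvPolynomial.eval₂_C, RingHom.comp_apply, ← algebraMap_rationalFunctions]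
      exact algebraMap_mem _ _
    | add p q hp hq =>
      rw [MvPolynomial.eval₂_add, map_add]
      exact add_mem hp hq
    | mul_X p i hp =>
      rw [MvPolynomial.eval₂_mul, MvPolynomial.eval₂_X, map_mul]
      exact mul_mem hp (IntermediateField.subset_adjoin _ _ ⟨i, rfl⟩)

theorem IsRadicalGerm.isSolvableGerm {x : Space N} {f : Space N → ℂ} (h : IsRadicalGerm x f) :
    IsSolvableGerm x f := by
  induction h with
  | rational x A B f hB hf h =>
    -- Adjoining the empty family leaves the base field, which contains `A / B`.
    refine ⟨hf, .of_mem_adjoin (ι := Empty) (g := Empty.elim) (fun i => i.elim) ?_⟩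
    have hB' : toGermField x (polyFun x B) ≠ 0 := fun h0 =>
      hB (polyFun_eventuallyEq_zero (toGermField_eq_zero.mp h0))
    have hfB : toGermField x ⟨f, hf⟩ * toGermField x (polyFun x B) =
        toGermField x (polyFun x A) := by
      rw [← map_mul]
      exact toGermField_eq h
    rw [eq_div_of_mul_eq hB' hfB, ← algebraMap_rationalFunctions, ← algebraMap_rationalFunctions]
    exact div_mem (algebraMap_mem _ _) (algebraMap_mem _ _)
  | comp x k A B g f _ hB hf h ih =>
    choose hga hgs using ih
    refine ⟨hf, .of_mem_adjoin hgs ?_⟩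
    obtain ⟨a, ha, haG⟩ := exists_toGermField_mem_adjoin (fun i => ⟨g i, hga i⟩) A
    obtain ⟨b, hb, hbG⟩ := exists_toGermField_mem_adjoin (fun i => ⟨g i, hga i⟩) B
    have hb0 : toGermField x b ≠ 0 := fun h0 => hB <| by
      filter_upwards [toGermField_eq_zero.mp h0] with z hz
      exact (hb z).symm.trans hz
    have hfb : toGermField x ⟨f, hf⟩ * toGermField x b = toGermField x a := by
      rw [← map_mul]
      refine toGermField_eq ?_
      filter_upwards [h] with z hz
      rw [ha z, ← hz, ← hb z]
      rfl
    rw [eq_div_of_mul_eq hb0 hfb]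
    exact div_mem haG hbG
  | radical x q g f hq _ hf h ih =>
    obtain ⟨hg, hgs⟩ := ih
    refine ⟨hf, .of_pow hq.ne' ?_⟩
    have hfg : toGermField x ⟨f, hf⟩ ^ q = toGermField x ⟨g, hg⟩ := by
      rw [← map_pow]
      exact toGermField_eq h
    rwa [hfg]
  | continuation a b γ g f _ h ih => exact ih.continuation h

/-! ### Monodromy and the conclusion. -/

/-- The monodromy group is solvable if the Galois group over the rational functions is. -/
theorem isSolvable_monodromyGroup {P : Polynomial (MvPolynomial (Fin N) ℂ)}
    (hP0 : P.map (algebraMap _ (RationalFunctions N)) ≠ 0)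
    (hPs : Group.IsSolvable (P.map (algebraMap _ (RationalFunctions N))).Gal) {x₀ : Space N}
    (hx₀ : x₀ ∉ singularSet P) : Group.IsSolvable (monodromyGroup P x₀ hx₀) := by
  have hsol : ∀ φ : solutionGerms P x₀, ∃ f : Space N → ℂ, AnalyticAt ℂ f x₀ ∧
    (∀ᶠ z in 𝓝 x₀, evalAt P z (f z) = 0) ∧ (f : Germ (𝓝 x₀) ℂ) = φ.1 := fun φ => φ.2
  choose f hf hfP hfφ using hsol
  let v : solutionGerms P x₀ → GermField x₀ := fun φ => toGermField x₀ ⟨f φ, hf φ⟩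
  have hinj : Function.Injective v := by
    intro φ ψ h
    have h' := sub_eq_zero.mpr h
    rw [← map_sub, toGermField_eq_zero] at h'
    refine Subtype.ext ?_
    rw [← hfφ, ← hfφ, Germ.coe_eq]
    filter_upwards [h'] with z hz
    exact sub_eq_zero.mp hz
  refine isSolvable_of_preserves_relations hP0 hPs hinj
    (fun φ => (aeval_toGermField_map x₀ ⟨f φ, hf φ⟩ P).mpr (hfP φ)) _ ?_
  rintro σ ⟨γ, -, hγ⟩ r hr
  obtain ⟨d, hd, q, hq⟩ := MvPolynomial.exists_map_eq_C_mul (A := MvPolynomial (Fin N) ℂ) r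
  have hqv : (fun z => q.eval₂ (MvPolynomial.eval z) fun φ => f φ z) =ᶠ[𝓝 x₀] 0 := by
    refine (aeval_toGermField_mvMap x₀ (fun φ => ⟨f φ, hf φ⟩) q).mp ?_
    rw [hq, map_mul]
    exact mul_eq_zero_of_right _ hr
  -- The single loop `γ` continues all germs `f φ` to `f (σ φ)` simultaneously, so the value of `q`
  -- is continued along it and stays zero.
  have hqσ : (fun z => q.eval₂ (MvPolynomial.eval z) fun φ => f (σ φ) z) =ᶠ[𝓝 x₀] 0 := by
    choose F hF hloc hF0 hF1 using hγ
    have hF0' : ∀ φ, F φ 0 =ᶠ[𝓝 (γ 0)] f φ := fun φ => by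
      rw [γ.source]
      exact Germ.coe_eq.mp ((hF0 φ).trans (hfφ φ).symm)
    have hF1' : ∀ φ, F φ 1 =ᶠ[𝓝 (γ 1)] f (σ φ) := fun φ => by
      rw [γ.target]
      exact Germ.coe_eq.mp ((hF1 φ).trans (hfφ (σ φ)).symm)
    have key := eventuallyEq_zero_along_path (γ := γ)
      (F := fun t z => q.eval₂ (MvPolynomial.eval z) fun φ => F φ t z)
      (fun t => analyticAt_mvEval₂ (fun φ => hF φ t) q)
      (fun t => eventually_eventuallyEq_mvEval₂ (fun φ => hloc φ t) q)
      ((eventuallyEq_mvEval₂ hF0' q).trans (by rw [γ.source]; exact hqv)) 1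
    have := (eventuallyEq_mvEval₂ hF1' q).symm.trans key
    rwa [γ.target] at this
  have h := (aeval_toGermField_mvMap x₀ (fun φ => ⟨f (σ φ), hf (σ φ)⟩) q).mpr hqσ
  rw [hq, map_mul, mul_eq_zero, MvPolynomial.aeval_C] at h
  refine h.resolve_left ((map_ne_zero _).mpr ?_)
  exact (map_ne_zero_iff _ (IsFractionRing.injective _ _)).mpr hd

end AlgebraicFunctions
end

theorem theorem2p15 {N : ℕ} (P : Polynomial (MvPolynomial (Fin N) ℂ))
    (hP : Irreducible
      (P.map (algebraMap (MvPolynomial (Fin N) ℂ) (FractionRing (MvPolynomial (Fin N) ℂ)))))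
    (x₀ : AlgebraicFunctions.Space N) (hx₀ : x₀ ∉ AlgebraicFunctions.singularSet P)
    (hmon : ¬ Group.IsSolvable (AlgebraicFunctions.monodromyGroup P x₀ hx₀))
    (a : AlgebraicFunctions.Space N) (y : AlgebraicFunctions.Space N → ℂ)
    (hy : (y : Filter.Germ (nhds a) ℂ) ∈ AlgebraicFunctions.solutionGerms P a) :
    ¬ AlgebraicFunctions.IsRadicalGerm a y := by
  intro hrad
  obtain ⟨hya, hys⟩ := hrad.isSolvableGerm
  obtain ⟨f, -, hfP, hfy⟩ := hy
  have hyP : ∀ᶠ z in 𝓝 a, AlgebraicFunctions.evalAt P z (y z) = 0 := by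
    filter_upwards [hfP, Germ.coe_eq.mp hfy] with z hz hz'
    rwa [← hz']
  -- The germ at `a` and the monodromy at `x₀` meet only through the Galois group of `P`; no path
  -- joins the two points.
  exact hmon (AlgebraicFunctions.isSolvable_monodromyGroup hP.ne_zero
    (hys.isSolvable_gal hP
      ((AlgebraicFunctions.aeval_toGermField_map a ⟨y, hya⟩ P).mpr hyP)) hx₀)
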